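/- Let $R$ be a commutative unital ring that is indecomposable, that is, whose only idempotents are $0$ and $1$. Let $\mathscr{A}$ be an alphabet (a set of arbitrary cardinality), let $\mathscr{A}^*$ be the set of finite words over $\mathscr{A}$, with empty word $\omega$, and let $F\subseteq\mathscr{A}^*$ be a set of forbidden words. Let $\mathsf{X}=\mathsf{X}_F\subseteq\mathscr{A}^{\mathbb{N}}$ be the subshift of all sequences no block of which is in $F$, and let $\mathcal{L}_{\mathsf{X}}$ be its language, the set of all words $x_0\cdots x_{n-1}$ with $x\in\mathsf{X}$ and $n\ge 0$. For $\alpha,\beta\in\mathcal{L}_{\mathsf{X}}$ put $C(\alpha,\beta)=\{\beta x\in\mathsf{X}:\alpha x\in\mathsf{X}\}$, and let $\mathcal{U}$ be the Boolean algebra of subsets of $\mathsf{X}$ generated by all the sets $C(\alpha,\beta)$. The unital subshift algebra $\widetilde{\mathcal{A}}_R(\mathsf{X})$ is the universal unital $R$-algebra with generators $\{p_A:A\in\mathcal{U}\}$ and $\{s_a,s_a^*:a\in\mathscr{A}\}$ subject to the relations (i) $p_{\mathsf{X}}=1$, $p_{A\cap B}=p_Ap_B$, $p_{A\cup B}=p_A+p_B-p_{A\cap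 B}$ and $p_\emptyset=0$ for all $A,B\in\mathcal{U}$; (ii) $s_as_a^*s_a=s_a$ and $s_a^*s_as_a^*=s_a^*$ for all $a\in\mathscr{A}$; (iii) $s_\beta s_\alpha^*s_\alpha s_\beta^*=p_{C(\alpha,\beta)}$ for all $\alpha,\beta\in\mathcal{L}_{\mathsf{X}}$, where $s_\alpha=s_{\alpha_1}\cdots s_{\alpha_n}$ and $s_\alpha^*=s_{\alpha_n}^*\cdots s_{\alpha_1}^*$ for $\alpha=\alpha_1\cdots\alpha_n$, and $s_\omega=s_\omega^*=1$. The OTW-subshift $\mathsf{X}^{OTW}_F$ is the union of $\mathsf{X}_F$ and the set of all finite words $w$ (including possibly the empty word) for which there are infinitely many $a\in\mathscr{A}$ such that $way\in\mathsf{X}_F$ for some $y\in\mathscr{A}^{\mathbb{N}}$; a finite word $w$ is identified with the sequence $w\infty\infty\infty\cdots$, where $\infty\notin\mathscr{A}$ is a new symbol. It carries the topology generated by the generalised cylinder sets $$\mathcal{Z}(\alpha,G)=\{y\in\mathsf{X}^{OTW}_F: y \text{ starts with } \alpha \text{ and the next entry of } y \text{ is not in } G\},$$ where $\alpha\in\mathcal{L}_{\mathsf{X}}$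 and $G\subseteq\mathscr{A}$ is finite (the next entry may be $\infty$). For a topological space $Y$, let $\operatorname{Lc}(Y,R)$ denote the $R$-algebra of compactly supported locally constant functions $Y\to R$ with pointwise operations. Then $\operatorname{span}_R\{s_\alpha s_\alpha^*:\alpha\in\mathcal{L}_{\mathsf{X}}\}$, which is a unital subalgebra of $\widetilde{\mathcal{A}}_R(\mathsf{X})$, is isomorphic as an $R$-algebra to $\operatorname{Lc}(\mathsf{X}^{OTW}_F,R)$. -/

import Mathlib

/-!
Subshifts over an arbitrary alphabet, the unital algebra of a subshift, Ott-Tomforde-Willis (OTW)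
subshifts with the topology of generalised cylinders, and algebras of compactly supported locally
constant functions.

Words over an alphabet `A` are lists, infinite sequences are Mathlib's `Stream' A` (functions
`ℕ → A`), and `α ++ₛ x` is the concatenation of a word and a sequence.
-/

namespace OTW

universe u v

/-! ### Subshifts -/

section Subshift

variable {A : Type u}

/-- The subshift of the set `F` of forbidden words: the sequences no block of which lies in `F`.
The blocks of `x` are `x_k x_{k+1} … x_{k+n-1}` (for `n = 0` this is the empty word). -/
def subshift (F : Set (List A)) : Set (Stream' A) :=
  {x | ∀ k n : ℕ, (x.drop k).take n ∉ F}

/-- The language of `X`: the words `x_0 … x_{n-1}` with `x ∈ X`. -/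
def language (X : Set (Stream' A)) : Set (List A) :=
  {α | ∃ x ∈ X, x.take α.length = α}

/-- The set `C(α, β) = {β x ∈ X : α x ∈ X}`, as a subset of `X`. -/
def C (X : Set (Stream' A)) (α β : List A) : Set X :=
  {y | ∃ x : Stream' A, β ++ₛ x = y.1 ∧ α ++ₛ x ∈ X}

/-- The Boolean algebra of subsets of `X` generated by all `C(α, β)` with `α`, `β` in the language
of `X`. -/
def U (X : Set (Stream' A)) : BooleanSubalgebra (Set X) :=
  BooleanSubalgebra.closure {S | ∃ α ∈ language X, ∃ β ∈ language X, S = C X α β}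

theorem C_mem_U {X : Set (Stream' A)} {α β : List A} (hα : α ∈ language X)
    (hβ : β ∈ language X) : C X α β ∈ U X :=
  BooleanSubalgebra.subset_closure ⟨α, hα, β, hβ, rfl⟩

end Subshift

/-! ### The unital algebra of a subshift -/

section Algebra

variable {A : Type u}

/-- The generators `p_S` for `S` in the Boolean algebra `U X`, and `s_a`, `s_a^*` for letters `a`. -/
inductive Gen (X : Set (Stream' A)) : Type u
  | p (S : U X) : Gen X
  | s (a : A) : Gen X
  | sStar (a : A) : Gen X

/-- For a family `t` of elements of a monoid, `wordProd t (α_1 … α_n) = t_{α_1} ⋯ t_{α_n}`. -/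
def wordProd {M : Type*} [Monoid M] (t : A → M) (α : List A) : M := (α.map t).prod

/-- For a family `t` of elements of a monoid,
`wordProdRev t (α_1 … α_n) = t_{α_n} ⋯ t_{α_1}`. -/
def wordProdRev {M : Type*} [Monoid M] (t : A → M) (α : List A) : M := (α.reverse.map t).prod

variable (R : Type v) [CommRing R]

open FreeAlgebra in
/-- The defining relations of the unital algebra of a subshift. -/
inductive Rel (X : Set (Stream' A)) : FreeAlgebra R (Gen X) → FreeAlgebra R (Gen X) → Prop
  | p_top : Rel X (ι R (Gen.p ⊤)) 1
  | p_inf (S T : U X) : Rel X (ι R (Gen.p (S ⊓ T))) (ι R (Gen.p S) * ι R (Gen.p T))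
  | p_sup (S T : U X) : Rel X (ι R (Gen.p (S ⊔ T)))
      (ι R (Gen.p S) + ι R (Gen.p T) - ι R (Gen.p (S ⊓ T)))
  | p_bot : Rel X (ι R (Gen.p ⊥)) 0
  | s_sStar_s (a : A) : Rel X
      (ι R (Gen.s a) * ι R (Gen.sStar a) * ι R (Gen.s a)) (ι R (Gen.s a))
  | sStar_s_sStar (a : A) : Rel X
      (ι R (Gen.sStar a) * ι R (Gen.s a) * ι R (Gen.sStar a)) (ι R (Gen.sStar a))
  | p_C (α β : List A) (hα : α ∈ language X) (hβ : β ∈ language X) : Rel X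
      (wordProd (fun a => ι R (Gen.s a)) β * wordProdRev (fun a => ι R (Gen.sStar a)) α *
        wordProd (fun a => ι R (Gen.s a)) α * wordProdRev (fun a => ι R (Gen.sStar a)) β)
      (ι R (Gen.p ⟨C X α β, C_mem_U hα hβ⟩))

/-- The unital subshift algebra: the universal unital `R`-algebra on the generators `Gen X` subject
to the relations `Rel R X`. -/
abbrev SubshiftAlgebra (X : Set (Stream' A)) : Type (max u v) := RingQuot (Rel R X)

variable {R}

/-- The image of a generator in the unital subshift algebra. -/
noncomputable def gen {X : Set (Stream' A)} (g : Gen X) : SubshiftAlgebra R X :=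
  RingQuot.mkAlgHom R (Rel R X) (FreeAlgebra.ι R g)

variable (R)

/-- `s_α = s_{α_1} ⋯ s_{α_n}` in the unital subshift algebra. -/
noncomputable def s (X : Set (Stream' A)) (α : List A) : SubshiftAlgebra R X :=
  wordProd (fun a => gen (Gen.s a)) α

/-- `s_α^* = s_{α_n}^* ⋯ s_{α_1}^*` in the unital subshift algebra. -/
noncomputable def sStar (X : Set (Stream' A)) (α : List A) : SubshiftAlgebra R X :=
  wordProdRev (fun a => gen (Gen.sStar a)) α

/-- The `R`-linear span of the elements `s_α s_α^*`, `α` in the language of `X`. -/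
noncomputable def cylSpan (X : Set (Stream' A)) : Submodule R (SubshiftAlgebra R X) :=
  Submodule.span R {e | ∃ α ∈ language X, e = s R X α * sStar R X α}

end Algebra

/-! The span of the `s_α s_α^*` is a unital subalgebra. -/

section Subalgebra

variable {A : Type u} (R : Type v) [CommRing R]

theorem drop_mem_subshift {F : Set (List A)} {x : Stream' A} (hx : x ∈ subshift F) (m : ℕ) :
    x.drop m ∈ subshift F := by
  intro k n
  rw [Stream'.drop_drop]
  exact hx _ n

theorem mem_C_nil {F : Set (List A)} {β : List A} {y : subshift F} :
    y ∈ C (subshift F) [] β ↔ y.1.take β.length = β := by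
  constructor
  · rintro ⟨x, hx, -⟩
    rw [← hx, Stream'.take_append_of_le_length (h := le_rfl), List.take_length]
  · intro h
    refine ⟨y.1.drop β.length, ?_, drop_mem_subshift y.2 _⟩
    conv_lhs => rw [← h]
    rw [Stream'.length_take]
    exact Stream'.append_take_drop _ _

theorem C_nil_inter_of_length_le {F : Set (List A)} {α β : List A} (h : α.length ≤ β.length) :
    C (subshift F) [] α ∩ C (subshift F) [] β = C (subshift F) [] β ∨
      C (subshift F) [] α ∩ C (subshift F) [] β = ∅ := by
  by_cases hp : β.take α.length = α
  · left
    ext y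
    simp only [Set.mem_inter_iff, mem_C_nil, and_iff_right_iff_imp]
    intro hy
    rw [← hp, ← hy, Stream'.take_take]
    simp [Stream'.length_take, h]
  · right
    ext y
    simp only [Set.mem_inter_iff, mem_C_nil, Set.mem_empty_iff_false, iff_false, not_and]
    intro h1 h2
    apply hp
    conv_rhs => rw [← h1]
    conv_lhs => rw [← h2]
    rw [Stream'.take_take, min_eq_right h]

theorem nil_mem_language {X : Set (Stream' A)} (hX : X.Nonempty) : [] ∈ language X :=
  let ⟨x, hx⟩ := hX
  ⟨x, hx, rfl⟩

theorem nil_mem_language_of_mem {X : Set (Stream' A)} {α : List A} (hα : α ∈ language X) :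
    [] ∈ language X :=
  let ⟨x, hx, _⟩ := hα
  ⟨x, hx, rfl⟩

theorem map_wordProd {M N : Type*} [Monoid M] [Monoid N] (f : M →* N) (t : A → M) (α : List A) :
    f (wordProd t α) = wordProd (fun a => f (t a)) α := by
  simp [wordProd, map_list_prod, Function.comp_def]

theorem map_wordProdRev {M N : Type*} [Monoid M] [Monoid N] (f : M →* N) (t : A → M)
    (α : List A) : f (wordProdRev t α) = wordProdRev (fun a => f (t a)) α := by
  simp [wordProdRev, map_list_prod, Function.comp_def]

theorem s_mul_sStar {X : Set (Stream' A)} {α : List A} (hα : α ∈ language X) :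
    s R X α * sStar R X α = gen (Gen.p ⟨C X [] α, C_mem_U (nil_mem_language_of_mem hα) hα⟩) := by
  have h := RingQuot.mkAlgHom_rel R (Rel.p_C (R := R) [] α (nil_mem_language_of_mem hα) hα)
  have h1 := map_wordProd (RingQuot.mkAlgHom R (Rel R X)).toMonoidHom
    (fun a => FreeAlgebra.ι R (Gen.s a)) α
  have h2 := map_wordProdRev (RingQuot.mkAlgHom R (Rel R X)).toMonoidHom
    (fun a => FreeAlgebra.ι R (Gen.sStar a)) α
  change RingQuot.mkAlgHom R (Rel R X) _ = _ at h1
  change RingQuot.mkAlgHom R (Rel R X) _ = _ at h2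
  rw [map_mul, h2, map_mul, map_mul, h1] at h
  simp only [wordProd, wordProdRev, List.map_nil, List.prod_nil, List.reverse_nil, map_one,
    mul_one] at h
  exact h

theorem gen_p_inf {X : Set (Stream' A)} (S T : U X) :
    (gen (Gen.p (S ⊓ T)) : SubshiftAlgebra R X) = gen (Gen.p S) * gen (Gen.p T) := by
  simpa [gen] using RingQuot.mkAlgHom_rel R (Rel.p_inf (R := R) S T)

theorem gen_p_bot {X : Set (Stream' A)} : (gen (Gen.p ⊥) : SubshiftAlgebra R X) = 0 := by
  simpa [gen] using RingQuot.mkAlgHom_rel R (Rel.p_bot (R := R) (X := X))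

theorem gen_p_top {X : Set (Stream' A)} : (gen (Gen.p ⊤) : SubshiftAlgebra R X) = 1 := by
  simpa [gen] using RingQuot.mkAlgHom_rel R (Rel.p_top (R := R) (X := X))

theorem one_mem_cylSpan (X : Set (Stream' A)) : (1 : SubshiftAlgebra R X) ∈ cylSpan R X := by
  rcases X.eq_empty_or_nonempty with hX | hX
  · have h : (⊤ : U X) = ⊥ := by
      apply Subtype.ext
      ext y
      exact absurd y.2 (by simp [hX])
    rw [← gen_p_top, h, gen_p_bot]
    exact Submodule.zero_mem _
  · exact Submodule.subset_span ⟨[], nil_mem_language hX,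
      by simp [s, sStar, wordProd, wordProdRev]⟩

theorem mul_mem_cylSpan (F : Set (List A)) {e f : SubshiftAlgebra R (subshift F)}
    (he : e ∈ cylSpan R (subshift F)) (hf : f ∈ cylSpan R (subshift F)) :
    e * f ∈ cylSpan R (subshift F) := by
  have hmul := Submodule.mul_mem_mul he hf
  rw [cylSpan, Submodule.span_mul_span] at hmul
  refine Submodule.span_le.2 ?_ hmul
  rintro _ ⟨_, ⟨α, hα, rfl⟩, _, ⟨β, hβ, rfl⟩, rfl⟩
  have key : C (subshift F) [] α ∩ C (subshift F) [] β = C (subshift F) [] α ∨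
      C (subshift F) [] α ∩ C (subshift F) [] β = C (subshift F) [] β ∨
      C (subshift F) [] α ∩ C (subshift F) [] β = ∅ := by
    rcases le_total α.length β.length with h | h
    · exact Or.inr (C_nil_inter_of_length_le h)
    · rw [Set.inter_comm]
      rcases C_nil_inter_of_length_le (F := F) h with h | h
      · exact Or.inl h
      · exact Or.inr (Or.inr h)
  simp only [s_mul_sStar R hα, s_mul_sStar R hβ, ← gen_p_inf, SetLike.mem_coe]
  rcases key with h | h | h
  · refine Submodule.subset_span ⟨α, hα, ?_⟩
    rw [s_mul_sStar R hα]
    exact congrArg (fun S => gen (Gen.p S)) (Subtype.ext h)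
  · refine Submodule.subset_span ⟨β, hβ, ?_⟩
    rw [s_mul_sStar R hβ]
    exact congrArg (fun S => gen (Gen.p S)) (Subtype.ext h)
  · convert Submodule.zero_mem (cylSpan R (subshift F))
    rw [← gen_p_bot]
    exact congrArg (fun S => gen (Gen.p S)) (Subtype.ext h)

/-- The span of the `s_α s_α^*`, `α` in the language of the subshift of `F`, as a unital
`R`-subalgebra of the unital subshift algebra. -/
noncomputable def cylAlgebra (F : Set (List A)) : Subalgebra R (SubshiftAlgebra R (subshift F)) :=
  (cylSpan R (subshift F)).toSubalgebra (one_mem_cylSpan R _) fun _ _ => mul_mem_cylSpan R F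

end Subalgebra

/-! ### OTW-subshifts -/

section OTWShift

variable {A : Type u}

/-- The finite part of the OTW-subshift, as a set of words: the words `w` such that there are
infinitely many letters `a` for which `w a y` lies in the subshift for some sequence `y`.
(When the alphabet is finite there are none.) -/
def finPart (F : Set (List A)) : Set (List A) :=
  {w | {a : A | ∃ y : Stream' A, w ++ₛ ([a] ++ₛ y) ∈ subshift F}.Infinite}

/-- The sequence `w_0 … w_k ∞ ∞ ∞ …` in the extended alphabet `A ∪ {∞}`, which is `Option A` with
`∞ = none`; it represents the finite word `w`. -/
def pad (w : List A) : Stream' (Option A) := w.map some ++ₛ Stream'.const none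

/-- The OTW-subshift of `F`, the union of the subshift of `F` and of the finite part, as a type of
sequences in the extended alphabet. -/
def OTWShift (F : Set (List A)) : Type u :=
  {x : Stream' (Option A) // x ∈ Stream'.map some '' subshift F ∪ pad '' finPart F}

/-- The generalised cylinder set `Z(α, G)`: the points that start with `α` and whose next entry is
not in `G` (it may be `∞`). -/
def genCylinder (F : Set (List A)) (α : List A) (G : Finset A) : Set (OTWShift F) :=
  {y | y.1.take α.length = α.map some ∧ ∀ a ∈ G, y.1.get α.length ≠ some a}

/-- The topology generated by the generalised cylinders `Z(α, G)`, with `α` in the language and `G`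
a finite set of letters. -/
instance (F : Set (List A)) : TopologicalSpace (OTWShift F) :=
  TopologicalSpace.generateFrom
    {S | ∃ α ∈ language (subshift F), ∃ G : Finset A, S = genCylinder F α G}

end OTWShift

/-! ### Compactly supported locally constant functions -/

/-- `Lc(X, R)`: the `R`-algebra of compactly supported locally constant functions `X → R` with
pointwise operations (it has a unit only if `X` is compact, hence a non-unital subalgebra). -/
def Lc (X : Type u) [TopologicalSpace X] (R : Type v) [CommRing R] :
    NonUnitalSubalgebra R (LocallyConstant X R) where
  carrier := {f | HasCompactSupport f}
  add_mem' := fun hf hg => HasCompactSupport.add hf hg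
  zero_mem' := HasCompactSupport.zero
  mul_mem' := fun hf _ => HasCompactSupport.mul_right hf
  smul_mem' := fun r _ hf => HasCompactSupport.smul_left (f := fun _ => r) hf

end OTW

open Filter Topology

namespace OTW

universe u v

/-! ### The representation on functions on the subshift -/

section Words

variable {A : Type u}

/-! Both algebras embed in the algebra of all functions `subshift F → R`, and the images coincide.

The subshift algebra acts on these functions: `s_a` and `s_a^*` by adding and removing a first
letter, `p_S` by multiplication by the indicator of `S` (`genOp_rel`). Evaluating at the constant
`1` turns `p_S` into that indicator. This is injective on the span of the `p_S`, since the Boolean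
relations alone determine a combination of the `p_S` from its function
(`linearCombination_gen_p_mul`).

On the other side, functions on the OTW-subshift are restricted to the infinite sequences. These are
dense (`denseRange_incl`), so a locally constant function is determined by its restriction. The
OTW-subshift is compact, by an ultrafilter argument (`exists_cyl_mem_ultrafilter_iff`), and
cylinders are clopen. Hence every clopen set is a Boolean combination of cylinders, and locally
constant functions are finite combinations of indicators of clopen sets (`comp_incl_mem`).

The cylinder of `α` restricts to `C(ω, α)`, the set of `s_α s_α^*`, so each image contains the
other. -/

theorem mem_subshift_of_append {F : Set (List A)} {α : List A} {x : Stream' A}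
    (h : α ++ₛ x ∈ subshift F) : x ∈ subshift F := by
  simpa [Stream'.drop_append_stream] using drop_mem_subshift h α.length

theorem mem_subshift_of_cons {F : Set (List A)} {a : A} {x : Stream' A}
    (h : Stream'.cons a x ∈ subshift F) : x ∈ subshift F :=
  mem_subshift_of_append (α := [a]) h

theorem wordProd_cons {M : Type*} [Monoid M] (t : A → M) (a : A) (α : List A) :
    wordProd t (a :: α) = t a * wordProd t α := by
  simp [wordProd]

theorem wordProdRev_cons {M : Type*} [Monoid M] (t : A → M) (a : A) (α : List A) :
    wordProdRev t (a :: α) = wordProdRev t α * t a := by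
  simp [wordProdRev]

end Words

section Representation

variable {A : Type u} (R : Type v) [CommRing R] {F : Set (List A)}

variable {R} in
open Classical in
/-- The extension by zero of a function on the subshift to all sequences. -/
noncomputable def extendZero (f : subshift F → R) (x : Stream' A) : R :=
  if h : x ∈ subshift F then f ⟨x, h⟩ else 0

variable {R} in
@[simp]
theorem extendZero_coe (f : subshift F → R) (x : subshift F) : extendZero f x.1 = f x := by
  simp [extendZero]

variable {R} in
theorem extendZero_of_mem (f : subshift F → R) {x : Stream' A} (h : x ∈ subshift F) :
    extendZero f x = f ⟨x, h⟩ :=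
  extendZero_coe f ⟨x, h⟩

variable {R} in
theorem extendZero_of_notMem (f : subshift F → R) {x : Stream' A} (h : x ∉ subshift F) :
    extendZero f x = 0 :=
  dif_neg h

variable {R} in
theorem ext_extendZero {f g : subshift F → R}
    (h : ∀ x ∈ subshift F, extendZero f x = extendZero g x) : f = g :=
  funext fun x => by simpa using h x.1 x.2

theorem extendZero_add (f g : subshift F → R) (x : Stream' A) :
    extendZero (f + g) x = extendZero f x + extendZero g x := by
  by_cases h : x ∈ subshift F <;> simp [extendZero, h]

theorem extendZero_smul (r : R) (f : subshift F → R) (x : Stream' A) :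
    extendZero (r • f) x = r * extendZero f x := by
  by_cases h : x ∈ subshift F <;> simp [extendZero, h]

open Classical in
/-- The operator by which `s_a` acts on functions on the subshift. -/
noncomputable def shiftOp (F : Set (List A)) (a : A) : Module.End R (subshift F → R) where
  toFun f y := if y.1.head = a then extendZero f y.1.tail else 0
  map_add' f g := by
    ext y
    by_cases h : y.1.head = a <;> simp [h, extendZero_add]
  map_smul' r f := by
    ext y
    by_cases h : y.1.head = a <;> simp [h, extendZero_smul]

/-- The operator by which `s_a^*` acts on functions on the subshift. -/
noncomputable def coshiftOp (F : Set (List A)) (a : A) : Module.End R (subshift F → R) where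
  toFun f x := extendZero f (Stream'.cons a x.1)
  map_add' f g := by
    ext y
    simp [extendZero_add]
  map_smul' r f := by
    ext y
    simp [extendZero_smul]

theorem extendZero_shiftOp_cons (f : subshift F → R) {a : A} {x : Stream' A}
    (h : Stream'.cons a x ∈ subshift F) :
    extendZero (shiftOp R F a f) (Stream'.cons a x) = extendZero f x := by
  rw [extendZero_of_mem _ h]
  simp [shiftOp]

theorem extendZero_coshiftOp (f : subshift F → R) (a : A) (x : Stream' A) :
    extendZero (coshiftOp R F a f) x = extendZero f (Stream'.cons a x) := by
  by_cases h : x ∈ subshift F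
  · rw [extendZero_of_mem _ h]
    rfl
  · rw [extendZero_of_notMem _ h, extendZero_of_notMem _ fun h' => h (mem_subshift_of_cons h')]

theorem extendZero_wordProd_append (f : subshift F → R) (α : List A) {x : Stream' A}
    (h : α ++ₛ x ∈ subshift F) :
    extendZero (wordProd (shiftOp R F) α f) (α ++ₛ x) = extendZero f x := by
  induction α with
  | nil => simp [wordProd]
  | cons a α ih =>
    rw [wordProd_cons, Module.End.mul_apply, Stream'.cons_append_stream,
      extendZero_shiftOp_cons R _ h, ih (mem_subshift_of_cons h)]

theorem wordProd_shiftOp_of_take_ne (f : subshift F → R) (α : List A) (y : subshift F)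
    (h : y.1.take α.length ≠ α) : wordProd (shiftOp R F) α f y = 0 := by
  induction α generalizing y with
  | nil => simp at h
  | cons a α ih =>
    rw [wordProd_cons, Module.End.mul_apply]
    by_cases ha : y.1.head = a
    · have hy : y.1.tail ∈ subshift F := drop_mem_subshift y.2 1
      have := ih ⟨_, hy⟩ (by simpa [Stream'.take_succ, ha] using h)
      simp [shiftOp, ha, extendZero_of_mem _ hy, this]
    · simp [shiftOp, ha]

theorem extendZero_wordProdRev (f : subshift F → R) (α : List A) (x : Stream' A) :
    extendZero (wordProdRev (coshiftOp R F) α f) x = extendZero f (α ++ₛ x) := by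
  induction α generalizing f with
  | nil => simp [wordProdRev]
  | cons a α ih =>
    rw [wordProdRev_cons, Module.End.mul_apply, ih, extendZero_coshiftOp,
      Stream'.cons_append_stream]

/-- The operator by which a generator of the subshift algebra acts on functions on the subshift;
`p_S` acts as multiplication by the indicator function of `S`. -/
noncomputable def genOp (F : Set (List A)) :
    Gen (subshift F) → Module.End R (subshift F → R)
  | Gen.p S => Algebra.lmul R (subshift F → R) (Set.indicator S.1 1)
  | Gen.s a => shiftOp R F a
  | Gen.sStar a => coshiftOp R F a

theorem genOp_rel {x y : FreeAlgebra R (Gen (subshift F))} (h : Rel R (subshift F) x y) :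
    FreeAlgebra.lift R (genOp R F) x = FreeAlgebra.lift R (genOp R F) y := by
  induction h with
  | p_top =>
    simp only [map_one, FreeAlgebra.lift_ι_apply, genOp]
    exact (congrArg _ (Set.indicator_univ 1)).trans (map_one (Algebra.lmul R (subshift F → R)))
  | p_inf S T =>
    simp only [map_mul, FreeAlgebra.lift_ι_apply, genOp]
    rw [← map_mul]
    congr 1
    exact Set.inter_indicator_one
  | p_sup S T =>
    simp only [map_add, map_sub, FreeAlgebra.lift_ι_apply, genOp]
    rw [← map_add, ← map_sub]
    congr 1
    exact eq_sub_of_add_eq (Set.indicator_union_add_inter 1 S.1 T.1)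
  | p_bot =>
    simp only [map_zero, FreeAlgebra.lift_ι_apply, genOp]
    exact (congrArg _ (Set.indicator_empty 1)).trans (map_zero (Algebra.lmul R (subshift F → R)))
  | s_sStar_s a =>
    simp only [map_mul, FreeAlgebra.lift_ι_apply, genOp]
    refine LinearMap.ext fun f => funext fun y => ?_
    by_cases ha : y.1.head = a
    · subst ha
      have e : Stream'.cons y.1.head y.1.tail = y.1 := Stream'.eta _
      have h : Stream'.cons y.1.head y.1.tail ∈ subshift F := e ▸ y.2
      have key (g : subshift F → R) :
          shiftOp R F y.1.head g y = extendZero g y.1.tail := by simp [shiftOp]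
      rw [Module.End.mul_apply, Module.End.mul_apply, key, key, extendZero_coshiftOp,
        extendZero_shiftOp_cons R _ h]
    · simp [shiftOp, ha]
  | sStar_s_sStar a =>
    simp only [map_mul, FreeAlgebra.lift_ι_apply, genOp]
    refine LinearMap.ext fun f => ext_extendZero fun x hx => ?_
    simp only [Module.End.mul_apply]
    rw [extendZero_coshiftOp]
    by_cases h : Stream'.cons a x ∈ subshift F
    · rw [extendZero_shiftOp_cons R _ h]
    · rw [extendZero_of_notMem _ h, extendZero_coshiftOp, extendZero_of_notMem _ h]
  | p_C α β hα hβ =>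
    have h1 (γ : List A) : FreeAlgebra.lift R (genOp R F)
        (wordProd (fun a => FreeAlgebra.ι R (Gen.s a)) γ) = wordProd (shiftOp R F) γ := by
      simpa [genOp] using map_wordProd (FreeAlgebra.lift R (genOp R F)).toMonoidHom
        (fun a => FreeAlgebra.ι R (Gen.s a)) γ
    have h2 (γ : List A) : FreeAlgebra.lift R (genOp R F)
        (wordProdRev (fun a => FreeAlgebra.ι R (Gen.sStar a)) γ) =
          wordProdRev (coshiftOp R F) γ := by
      simpa [genOp] using map_wordProdRev (FreeAlgebra.lift R (genOp R F)).toMonoidHom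
        (fun a => FreeAlgebra.ι R (Gen.sStar a)) γ
    simp only [map_mul, FreeAlgebra.lift_ι_apply, genOp, h1, h2]
    refine LinearMap.ext fun f => funext fun y => ?_
    simp only [Module.End.mul_apply]
    change _ = Set.indicator (C (subshift F) α β) 1 y * f y
    -- At `y = βx` the operator `s_β` reads its argument at `x`. There `s_α^* s_α` keeps the value
    -- if `αx` is in the subshift and kills it otherwise, and `s_β^*` reads `f` at `βx = y`. If `y`
    -- does not start with `β`, both sides vanish.
    by_cases hy : y.1.take β.length = β
    · have e : β ++ₛ y.1.drop β.length = y.1 := by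
        conv_lhs => rw [← hy, Stream'.length_take]
        exact Stream'.append_take_drop _ _
      have hC : y ∈ C (subshift F) α β ↔ α ++ₛ y.1.drop β.length ∈ subshift F := by
        constructor
        · rintro ⟨x, hx, hx'⟩
          rwa [← hx, Stream'.drop_append_stream]
        · exact fun h => ⟨_, e, h⟩
      have hmem : β ++ₛ y.1.drop β.length ∈ subshift F := e.symm ▸ y.2
      have key (g : subshift F → R) : g y = extendZero g (β ++ₛ y.1.drop β.length) := by
        rw [e, extendZero_coe]
      rw [key (wordProd (shiftOp R F) β _), extendZero_wordProd_append R _ _ hmem, extendZero_wordProdRev]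
      by_cases h : α ++ₛ y.1.drop β.length ∈ subshift F
      · rw [extendZero_wordProd_append R _ _ h, extendZero_wordProdRev, ← key,
          Set.indicator_of_mem (hC.2 h), Pi.one_apply, one_mul]
      · rw [extendZero_of_notMem _ h, Set.indicator_of_notMem (fun h' => h (hC.1 h')), zero_mul]
    · rw [wordProd_shiftOp_of_take_ne R _ _ _ hy, Set.indicator_of_notMem, zero_mul]
      rintro ⟨x, hx, -⟩
      apply hy
      rw [← hx, Stream'.take_append_of_le_length (h := le_rfl), List.take_length]

/-- The representation of the subshift algebra on functions on the subshift. -/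
noncomputable def rep (F : Set (List A)) :
    SubshiftAlgebra R (subshift F) →ₐ[R] Module.End R (subshift F → R) :=
  RingQuot.liftAlgHom R ⟨FreeAlgebra.lift R (genOp R F), fun _ _ h => genOp_rel R h⟩

theorem rep_gen (g : Gen (subshift F)) : rep R F (gen g) = genOp R F g := by
  simp [rep, gen]

/-! ### Faithfulness on the diagonal -/

/-- The span of the elements `p_S`. -/
noncomputable def diagSpan (F : Set (List A)) : Submodule R (SubshiftAlgebra R (subshift F)) :=
  Submodule.span R (Set.range fun S : U (subshift F) => gen (Gen.p S))

theorem cylSpan_le_diagSpan : cylSpan R (subshift F) ≤ diagSpan R F := by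
  refine Submodule.span_mono ?_
  rintro _ ⟨α, hα, rfl⟩
  exact ⟨_, (s_mul_sStar R hα).symm⟩

/-- The function on the subshift that represents an element of the diagonal. -/
noncomputable def diagFun (F : Set (List A)) :
    SubshiftAlgebra R (subshift F) →ₗ[R] (subshift F → R) :=
  LinearMap.applyₗ 1 ∘ₗ (rep R F).toLinearMap

theorem diagFun_apply (e : SubshiftAlgebra R (subshift F)) : diagFun R F e = rep R F e 1 := rfl

theorem diagFun_gen_p (S : U (subshift F)) :
    diagFun R F (gen (Gen.p S)) = Set.indicator S.1 1 := by
  rw [diagFun_apply, rep_gen]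
  exact mul_one _

/-- Each `p_S` acts as a multiplication operator, a property stable under linear combinations, and
such an operator is recovered from its value at `1`. This makes `diagFun` multiplicative on the
diagonal. -/
theorem rep_eq_lmul {e : SubshiftAlgebra R (subshift F)} (he : e ∈ diagSpan R F) :
    rep R F e = Algebra.lmul R (subshift F → R) (diagFun R F e) := by
  induction he using Submodule.span_induction with
  | mem _ h =>
    obtain ⟨S, rfl⟩ := h
    simp only [diagFun_gen_p, rep_gen, genOp]
  | zero => simp only [map_zero]
  | add x y _ _ hx hy => simp only [map_add, hx, hy]
  | smul r x _ hx => simp only [map_smul, hx]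

theorem diagFun_mul {e f : SubshiftAlgebra R (subshift F)} (he : e ∈ diagSpan R F) :
    diagFun R F (e * f) = diagFun R F e * diagFun R F f := by
  rw [diagFun_apply, map_mul, rep_eq_lmul R he, Module.End.mul_apply, ← diagFun_apply]
  rfl

theorem gen_p_inf_add_inf_compl (S T : U (subshift F)) :
    (gen (Gen.p (S ⊓ T)) + gen (Gen.p (Sᶜ ⊓ T)) : SubshiftAlgebra R (subshift F)) =
      gen (Gen.p T) := by
  have h := RingQuot.mkAlgHom_rel R (Rel.p_sup (R := R) (S ⊓ T) (Sᶜ ⊓ T))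
  rw [← inf_sup_right, sup_compl_eq_top, top_inf_eq, inf_inf_inf_comm, inf_compl_self,
    bot_inf_eq, map_sub, map_add] at h
  refine Eq.trans ?_ h.symm
  change _ = gen _ + gen _ - gen (Gen.p ⊥)
  rw [gen_p_bot, sub_zero]

/-- If the function of a combination `e` of the `p_S` has the constant value `c` on `T`, then
`e p_T = c p_T`. -/
theorem linearCombination_gen_p_mul (l : U (subshift F) →₀ R) (T : U (subshift F)) (c : R)
    (h : ∀ x ∈ T.1, diagFun R F
      (Finsupp.linearCombination R (fun S : U (subshift F) => gen (Gen.p S)) l) x = c) :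
    Finsupp.linearCombination R (fun S : U (subshift F) => gen (Gen.p S)) l * gen (Gen.p T) =
      c • (gen (Gen.p T) : SubshiftAlgebra R (subshift F)) := by
  induction l using Finsupp.induction generalizing T c with
  | zero =>
    -- For empty `T` the scalar `c` is arbitrary but `p_T = 0`; otherwise a point of `T` forces `c =
    -- 0`.
    rcases T.1.eq_empty_or_nonempty with hT | ⟨x, hx⟩
    · have : T = ⊥ := Subtype.ext hT
      rw [this, gen_p_bot, mul_zero, smul_zero]
    · have := h x hx
      simp only [map_zero, Pi.zero_apply] at this
      simp [← this]
  | single_add S r l _ _ ih =>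
    simp only [map_add, Finsupp.linearCombination_single, map_smul, diagFun_gen_p, Pi.add_apply,
      Pi.smul_apply, smul_eq_mul] at h ⊢
    -- Cutting `T` along `S` leaves the remaining combination constant on both pieces: `c - r`
    -- inside `S`, `c` outside. The induction must therefore allow `T` and `c` to vary.
    have h1 := ih (S ⊓ T) (c - r) fun x hx => by
      have := h x hx.2
      rw [Set.indicator_of_mem hx.1, Pi.one_apply, mul_one] at this
      rw [← this, add_sub_cancel_left]
    have h2 := ih (Sᶜ ⊓ T) c fun x hx => by
      have := h x hx.2
      rwa [Set.indicator_of_notMem (by exact hx.1), mul_zero, zero_add] at this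
    rw [add_mul, ← gen_p_inf_add_inf_compl R S T, mul_add, mul_add, h1, h2, smul_mul_assoc,
      smul_mul_assoc, ← gen_p_inf, ← gen_p_inf, ← inf_assoc, ← inf_assoc, inf_idem,
      inf_compl_self, bot_inf_eq, gen_p_bot, smul_zero, add_zero, ← add_assoc, ← add_smul,
      add_sub_cancel, smul_add]

theorem eq_zero_of_diagFun_eq_zero {e : SubshiftAlgebra R (subshift F)} (he : e ∈ diagSpan R F)
    (h : diagFun R F e = 0) : e = 0 := by
  obtain ⟨l, rfl⟩ := (Finsupp.mem_span_range_iff_exists_finsupp).1 he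
  have := linearCombination_gen_p_mul R l ⊤ 0 fun x _ => congrFun h x
  rwa [gen_p_top, mul_one, zero_smul] at this

/-- The algebra spanned by the `s_α s_α^*` acts on functions on the subshift by multiplication. -/
noncomputable def cylAlgebraFun (F : Set (List A)) : cylAlgebra R F →ₐ[R] (subshift F → R) :=
  AlgHom.ofLinearMap (diagFun R F ∘ₗ (cylAlgebra R F).val.toLinearMap)
    ((congrArg (diagFun R F) (gen_p_top R).symm).trans
      ((diagFun_gen_p R ⊤).trans (Set.indicator_univ 1)))
    fun e _ => diagFun_mul R (cylSpan_le_diagSpan R e.2)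

theorem cylAlgebraFun_injective : Function.Injective (cylAlgebraFun R F) := by
  rw [injective_iff_map_eq_zero]
  exact fun e he => Subtype.ext (eq_zero_of_diagFun_eq_zero R (cylSpan_le_diagSpan R e.2) he)

theorem cylAlgebraFun_s_mul_sStar {α : List A} (hα : α ∈ language (subshift F)) :
    cylAlgebraFun R F ⟨s R _ α * sStar R _ α, Submodule.subset_span ⟨α, hα, rfl⟩⟩ =
      Set.indicator (C (subshift F) [] α) 1 :=
  (congrArg (diagFun R F) (s_mul_sStar R hα)).trans (diagFun_gen_p R _)

theorem cylAlgebraFun_range_le {M : Submodule R (subshift F → R)}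
    (h : ∀ α ∈ language (subshift F), Set.indicator (C (subshift F) [] α) 1 ∈ M)
    (e : cylAlgebra R F) : cylAlgebraFun R F e ∈ M := by
  change diagFun R F e.1 ∈ M
  have he : e.1 ∈ cylSpan R (subshift F) := e.2
  rw [← Submodule.mem_comap]
  refine Submodule.span_le.2 ?_ he
  rintro _ ⟨α, hα, rfl⟩
  rw [SetLike.mem_coe, Submodule.mem_comap, s_mul_sStar R hα, diagFun_gen_p]
  exact h α hα

end Representation

/-! ### Words and points of the OTW-subshift -/

section Points

variable {A : Type u} {F : Set (List A)}

theorem take_map {B : Type*} (f : A → B) (n : ℕ) (x : Stream' A) :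
    (x.map f).take n = (x.take n).map f := by
  induction n generalizing x with
  | zero => rfl
  | succ n ih => rw [Stream'.take_succ, Stream'.take_succ, List.map_cons, ← ih, Stream'.head_map, Stream'.tail_map]

theorem take_drop_eq_drop_take (k n : ℕ) (x : Stream' A) :
    (x.drop k).take n = (x.take (k + n)).drop k := by
  induction k generalizing x with
  | zero => simp
  | succ k ih =>
    rw [Stream'.drop_succ, ih, Nat.succ_add, Stream'.take_succ, List.drop_succ_cons]

theorem take_length_append_singleton {B : Type*} (f : A → B) (y : Stream' B) (α : List A) (a : A) :
    y.take (α ++ [a]).length = (α ++ [a]).map f ↔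
      y.take α.length = α.map f ∧ y.get α.length = f a := by
  rw [List.length_append, List.length_singleton, Stream'.take_succ', List.map_append]
  constructor
  · intro h
    obtain ⟨h1, h2⟩ := List.append_inj h (by simp [Stream'.length_take])
    exact ⟨h1, by simpa using h2⟩
  · rintro ⟨h1, h2⟩
    simp [h1, h2]

theorem mem_language_of_append {X : Set (Stream' A)} {α : List A} {x : Stream' A}
    (h : α ++ₛ x ∈ X) : α ∈ language X :=
  ⟨_, h, by rw [Stream'.take_append_of_le_length (h := le_rfl), List.take_length]⟩

theorem exists_append_of_mem_language {F : Set (List A)} {α : List A}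
    (h : α ∈ language (subshift F)) : ∃ x : Stream' A, α ++ₛ x ∈ subshift F := by
  obtain ⟨y, hy, hα⟩ := h
  refine ⟨y.drop α.length, ?_⟩
  have := Stream'.append_take_drop α.length y
  rw [hα] at this
  rwa [this]

theorem mem_language_of_prefix {F : Set (List A)} {α β : List A} (hαβ : α <+: β)
    (h : β ∈ language (subshift F)) : α ∈ language (subshift F) := by
  obtain ⟨γ, rfl⟩ := hαβ
  obtain ⟨x, hx⟩ := exists_append_of_mem_language h
  rw [Stream'.append_append_stream] at hx
  exact mem_language_of_append hx

theorem mem_finPart {w : List A} :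
    w ∈ finPart F ↔ {a : A | w ++ [a] ∈ language (subshift F)}.Infinite := by
  have : {a : A | w ++ [a] ∈ language (subshift F)} =
      {a : A | ∃ y : Stream' A, w ++ₛ ([a] ++ₛ y) ∈ subshift F} := by
    ext a
    simp only [Set.mem_ofPred_eq, ← Stream'.append_append_stream]
    exact ⟨exists_append_of_mem_language, fun ⟨y, hy⟩ => mem_language_of_append hy⟩
  rw [this]
  rfl

theorem mem_language_of_mem_finPart {w : List A} (hw : w ∈ finPart F) :
    w ∈ language (subshift F) := by
  obtain ⟨a, ha⟩ := (mem_finPart.1 hw).nonempty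
  exact mem_language_of_prefix (List.prefix_append w [a]) ha

/-- A block of `x` lies inside some initial word of `x`, which is also an initial word of a point of
the subshift; so no block is forbidden. -/
theorem mem_subshift_of_take_mem_language {x : Stream' A}
    (h : ∀ n, x.take n ∈ language (subshift F)) : x ∈ subshift F := by
  intro k n
  obtain ⟨y, hy, hyx⟩ := h (k + n)
  rw [Stream'.length_take] at hyx
  rw [take_drop_eq_drop_take, ← hyx, ← take_drop_eq_drop_take]
  exact hy k n

theorem pad_nil : pad ([] : List A) = Stream'.const none := rfl

theorem pad_cons (a : A) (w : List A) : pad (a :: w) = Stream'.cons (some a) (pad w) := rfl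

theorem take_pad_eq_iff {α w : List A} :
    (pad w).take α.length = α.map some ↔ α <+: w := by
  induction α generalizing w with
  | nil => simp
  | cons a α ih =>
    cases w with
    | nil =>
      rw [pad_nil, Stream'.const_eq]
      simp
    | cons b w =>
      rw [pad_cons, List.length_cons, Stream'.take_succ_cons, List.map_cons, List.cons.injEq, ih,
        List.cons_prefix_cons, Option.some_inj, eq_comm]

theorem prefix_of_take_eq {B : Type*} {f : A → B} (hf : Function.Injective f) {y : Stream' B}
    {α β : List A} (hα : y.take α.length = α.map f) (hβ : y.take β.length = β.map f)
    (h : α.length ≤ β.length) : α <+: β := by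
  have : α = β.take α.length := by
    apply hf.list_map
    rw [List.map_take, ← hα, ← hβ, Stream'.take_take, min_eq_right h]
  rw [this]
  exact List.take_prefix _ _

/-- The inclusion of the subshift in the OTW-subshift. -/
def incl (F : Set (List A)) (x : subshift F) : OTWShift F :=
  ⟨x.1.map some, Or.inl ⟨x.1, x.2, rfl⟩⟩

/-- The point of the OTW-subshift given by a finite word. -/
def padPoint {w : List A} (hw : w ∈ finPart F) : OTWShift F :=
  ⟨pad w, Or.inr ⟨w, hw, rfl⟩⟩

/-- The set of points that start with a given word. -/
def cyl (F : Set (List A)) (α : List A) : Set (OTWShift F) := genCylinder F α ∅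

theorem mem_cyl {α : List A} {y : OTWShift F} :
    y ∈ cyl F α ↔ y.1.take α.length = α.map some := by
  simp [cyl, genCylinder]

theorem padPoint_mem_cyl {α w : List A} {hw : w ∈ finPart F} :
    padPoint hw ∈ cyl F α ↔ α <+: w := by
  rw [mem_cyl, padPoint, take_pad_eq_iff]

theorem cyl_nil : cyl F [] = Set.univ :=
  Set.eq_univ_of_forall fun _ => mem_cyl.2 rfl

/-- Reduces the topology to plain cylinders: excluding the next letters in `G` means removing
finitely many longer cylinders. -/
theorem mem_genCylinder {α : List A} {G : Finset A} {y : OTWShift F} :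
    y ∈ genCylinder F α G ↔ y ∈ cyl F α ∧ ∀ a ∈ G, y ∉ cyl F (α ++ [a]) := by
  simp only [mem_cyl, take_length_append_singleton, genCylinder, Set.mem_ofPred_eq, ne_eq]
  exact and_congr_right fun h => by simp [h]

theorem cyl_subset_of_prefix {α β : List A} (h : α <+: β) : cyl F β ⊆ cyl F α := by
  obtain ⟨γ, rfl⟩ := h
  intro y hy
  rw [mem_cyl] at hy ⊢
  have := congrArg (List.take α.length) hy
  simpa [Stream'.take_take] using this

theorem incl_mem_cyl {α : List A} {x : subshift F} :
    incl F x ∈ cyl F α ↔ x.1.take α.length = α := by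
  rw [mem_cyl, incl, take_map]
  exact (Option.some_injective A).list_map.eq_iff

theorem preimage_incl_cyl (α : List A) : incl F ⁻¹' cyl F α = C (subshift F) [] α := by
  ext x
  rw [Set.mem_preimage, incl_mem_cyl, mem_C_nil]

/-- Cylinders of words outside the language are empty, so later statements can range over all words.
-/
theorem mem_language_of_mem_cyl {α : List A} {y : OTWShift F} (hy : y ∈ cyl F α) :
    α ∈ language (subshift F) := by
  rw [mem_cyl] at hy
  obtain ⟨x, hx, h⟩ | ⟨w, hw, h⟩ := y.2
  · exact ⟨x, hx, incl_mem_cyl (x := ⟨x, hx⟩) |>.1 (mem_cyl.2 (by rwa [← h] at hy))⟩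
  · rw [← h, take_pad_eq_iff] at hy
    exact mem_language_of_prefix hy (mem_language_of_mem_finPart hw)

theorem mem_finPart_of_get_eq_none {α : List A} {y : OTWShift F} (hy : y ∈ cyl F α)
    (h : y.1.get α.length = none) : α ∈ finPart F := by
  rw [mem_cyl] at hy
  obtain ⟨x, hx, hxy⟩ | ⟨w, hw, hwy⟩ := y.2
  · rw [← hxy, Stream'.get_map] at h
    cases h
  · rw [← hwy, take_pad_eq_iff] at hy
    obtain ⟨_ | ⟨b, γ⟩, rfl⟩ := hy
    · simpa using hw
    -- If the finite word went on past `α`, its next letter `b` would stand where the entry is `∞`.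
    · have : (pad (α ++ b :: γ)).take (α ++ [b]).length = (α ++ [b]).map some :=
        take_pad_eq_iff.2 ⟨γ, by simp⟩
      rw [hwy, take_length_append_singleton, h] at this
      cases this.2

end Points

/-! ### Topology of the OTW-subshift -/

section Topology

variable {A : Type u} {F : Set (List A)}

theorem isOpen_genCylinder (α : List A) (G : Finset A) : IsOpen (genCylinder F α G) := by
  by_cases hα : α ∈ language (subshift F)
  · exact TopologicalSpace.isOpen_generateFrom_of_mem ⟨α, hα, G, rfl⟩
  · convert isOpen_empty
    exact Set.eq_empty_of_forall_notMem fun y hy =>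
      hα (mem_language_of_mem_cyl (mem_genCylinder.1 hy).1)

theorem isClopen_cyl (α : List A) : IsClopen (cyl F α) := by
  refine ⟨?_, isOpen_genCylinder α ∅⟩
  induction α using List.reverseRecOn with
  | nil => exact cyl_nil ▸ isClosed_univ
  | append_singleton α a ih =>
    -- The next entry after `α` is `a` exactly when the point leaves the open set `Z(α, {a})`; this
    -- gives closedness by induction on the word.
    have : cyl F (α ++ [a]) = cyl F α ∩ (genCylinder F α {a})ᶜ := by
      ext y
      have : y ∈ cyl F (α ++ [a]) → y ∈ cyl F α :=
        fun h => cyl_subset_of_prefix (List.prefix_append α [a]) h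
      simp only [Set.mem_inter_iff, Set.mem_compl_iff, mem_genCylinder, Finset.mem_singleton,
        forall_eq]
      tauto
    rw [this]
    exact ih.inter (isOpen_genCylinder α {a}).isClosed_compl

theorem ultrafilter_le_nhds (𝒰 : Ultrafilter (OTWShift F)) {y : OTWShift F}
    (h : ∀ α, y ∈ cyl F α ↔ cyl F α ∈ 𝒰) : (𝒰 : Filter (OTWShift F)) ≤ 𝓝 y := by
  rw [TopologicalSpace.nhds_generateFrom]
  simp only [le_iInf_iff, le_principal_iff]
  rintro _ ⟨hy, α, -, G, rfl⟩
  rw [mem_genCylinder] at hy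
  have : genCylinder F α G = cyl F α ∩ ⋂ a ∈ G, (cyl F (α ++ [a]))ᶜ := by
    ext z
    simp [mem_genCylinder]
  rw [this]
  refine inter_mem ((h α).1 hy.1) ((biInter_finset_mem G).2 fun a ha => ?_)
  rw [Ultrafilter.mem_coe, Ultrafilter.compl_mem_iff_notMem, ← h]
  exact hy.2 a ha

/-- The words whose cylinders belong to `𝒰` are comparable as prefixes. The limit is the word or
infinite sequence they spell out. -/
theorem exists_cyl_mem_ultrafilter_iff (𝒰 : Ultrafilter (OTWShift F)) :
    ∃ y : OTWShift F, ∀ α, y ∈ cyl F α ↔ cyl F α ∈ 𝒰 := by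
  have prefix_of_mem {α β : List A} (hα : cyl F α ∈ 𝒰) (hβ : cyl F β ∈ 𝒰)
      (h : α.length ≤ β.length) : α <+: β := by
    obtain ⟨y, h1, h2⟩ := 𝒰.nonempty_of_mem (inter_mem hα hβ)
    exact prefix_of_take_eq (Option.some_injective A) (mem_cyl.1 h1) (mem_cyl.1 h2) h
  have nil_mem : cyl F [] ∈ 𝒰 := cyl_nil ▸ univ_mem
  by_cases hw : ∃ w, cyl F w ∈ 𝒰 ∧ ∀ a, cyl F (w ++ [a]) ∉ 𝒰
  · obtain ⟨w, hw, hwa⟩ := hw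
    -- If only finitely many letters could follow `w`, the ultrafilter would contain the cylinder of
    -- `w` minus all its one-letter extensions, which is empty because `∞` cannot follow `w` either.
    have hfin : w ∈ finPart F := by
      by_contra hfin
      rw [mem_finPart, Set.not_infinite] at hfin
      have hmem : cyl F w ∩ ⋂ a ∈ {a : A | w ++ [a] ∈ language (subshift F)},
          (cyl F (w ++ [a]))ᶜ ∈ 𝒰 :=
        inter_mem hw ((biInter_mem hfin).2 fun a _ => Ultrafilter.compl_mem_iff_notMem.2 (hwa a))
      obtain ⟨y, hy, hya⟩ := 𝒰.nonempty_of_mem hmem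
      rcases hget : y.1.get w.length with _ | a
      · exact mem_finPart.1 (mem_finPart_of_get_eq_none hy hget) hfin
      · have : y ∈ cyl F (w ++ [a]) :=
          mem_cyl.2 ((take_length_append_singleton _ _ _ _).2 ⟨mem_cyl.1 hy, hget⟩)
        exact Set.mem_iInter₂.1 hya a (mem_language_of_mem_cyl this) this
    refine ⟨padPoint hfin, fun α => ?_⟩
    rw [padPoint_mem_cyl]
    refine ⟨fun h => mem_of_superset hw (cyl_subset_of_prefix h), fun h => ?_⟩
    rcases le_total α.length w.length with hle | hle
    · exact prefix_of_mem h hw hle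
    · obtain ⟨_ | ⟨b, γ⟩, rfl⟩ := prefix_of_mem hw h hle
      · simp
      · exact absurd (mem_of_superset h (cyl_subset_of_prefix ⟨γ, by simp⟩)) (hwa b)
  · push Not at hw
    have : Nonempty A := (hw [] nil_mem).nonempty
    choose! c hc using hw
    -- With no maximal word, extending by chosen letters gives an infinite sequence all of whose
    -- initial cylinders lie in `𝒰`.
    let W : ℕ → List A := fun n => n.rec [] fun _ w => w ++ [c w]
    have hW (n) : cyl F (W n) ∈ 𝒰 := by
      induction n with
      | zero => exact nil_mem
      | succ n ih => exact hc _ ih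
    let x : Stream' A := fun n => c (W n)
    have hx (n) : x.take n = W n := by
      induction n with
      | zero => rfl
      | succ n ih => rw [Stream'.take_succ', ih]; rfl
    have hmem (n) : cyl F (x.take n) ∈ 𝒰 := hx n ▸ hW n
    have hxX : x ∈ subshift F := mem_subshift_of_take_mem_language fun n =>
      (𝒰.nonempty_of_mem (hmem n)).elim fun _ => mem_language_of_mem_cyl
    refine ⟨incl F ⟨x, hxX⟩, fun α => ?_⟩
    rw [incl_mem_cyl]
    refine ⟨fun h => h ▸ hmem α.length, fun h => ?_⟩
    have hlen : (x.take α.length).length = α.length := Stream'.length_take _ _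
    exact (prefix_of_mem (hmem α.length) h hlen.le).eq_of_length hlen

instance : CompactSpace (OTWShift F) where
  isCompact_univ := isCompact_iff_ultrafilter_le_nhds.2 fun 𝒰 _ =>
    let ⟨y, hy⟩ := exists_cyl_mem_ultrafilter_iff 𝒰
    ⟨y, trivial, ultrafilter_le_nhds 𝒰 hy⟩

/-- A finite word `w` is the limit of sequences `w a x_a` as `a` runs through the infinitely many
admissible letters along the cofinite filter: `Z(α, G)` around `w` misses such a sequence only if `a
∈ G`. -/
theorem denseRange_incl : DenseRange (incl F) := by
  rintro ⟨y, hy⟩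
  obtain ⟨x, hx, rfl⟩ | ⟨w, hw, rfl⟩ := hy
  · exact subset_closure ⟨⟨x, hx⟩, rfl⟩
  · have hinf : Infinite {a : A | w ++ [a] ∈ language (subshift F)} :=
      (mem_finPart.1 hw).to_subtype
    choose x hx using fun a : {a : A | w ++ [a] ∈ language (subshift F)} =>
      exists_append_of_mem_language a.2
    have hstart (a) : incl F ⟨_, hx a⟩ ∈ cyl F (w ++ [a.1]) := by
      rw [incl_mem_cyl, Stream'.take_append_of_le_length (h := le_rfl), List.take_length]
    refine mem_closure_of_tendsto (f := fun a => incl F ⟨_, hx a⟩) (b := cofinite) ?_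
      (Eventually.of_forall fun a => Set.mem_range_self _)
    refine TopologicalSpace.tendsto_nhds_generateFrom_iff.2 ?_
    rintro _ ⟨α, -, G, rfl⟩ hmem
    change padPoint hw ∈ _ at hmem
    rw [mem_genCylinder, padPoint_mem_cyl] at hmem
    obtain ⟨hα, hG⟩ := hmem
    rw [mem_cofinite]
    refine ((G.finite_toSet).preimage Subtype.val_injective.injOn).subset fun a ha => ?_
    by_contra haG
    refine ha (mem_genCylinder.2
      ⟨cyl_subset_of_prefix (hα.trans (List.prefix_append _ _)) (hstart a), fun b hb hab => ?_⟩)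
    have hpre : α ++ [b] <+: w ++ [a.1] := by
      refine prefix_of_take_eq (Option.some_injective A) (mem_cyl.1 hab) (mem_cyl.1 (hstart a)) ?_
      simpa using hα.length_le
    rcases List.prefix_concat_iff.1 hpre with h | h
    · obtain ⟨-, h⟩ := List.append_inj' h rfl
      obtain rfl : b = a.1 := by simpa using h
      exact haG hb
    · exact hG b hb (padPoint_mem_cyl.2 h)

end Topology

/-! ### Locally constant functions -/

section LocallyConstant

variable {A : Type u} {F : Set (List A)} {R : Type v}

/-- The fibres of `f` and `g` through `y` are open, so their intersection meets the dense subshift.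
No topology on `R` is needed. -/
theorem eq_of_comp_incl_eq {f g : LocallyConstant (OTWShift F) R}
    (h : ∀ x, f (incl F x) = g (incl F x)) : f = g := by
  refine LocallyConstant.ext fun y => ?_
  have hopen : IsOpen (f ⁻¹' {f y} ∩ g ⁻¹' {g y}) :=
    (f.isLocallyConstant.isOpen_fiber _).inter (g.isLocallyConstant.isOpen_fiber _)
  obtain ⟨x, hf, hg⟩ := denseRange_incl.exists_mem_open hopen ⟨y, rfl, rfl⟩
  exact hf.symm.trans ((h x).trans hg)

variable [CommRing R] (N : Subalgebra R (subshift F → R))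

/-- The sets whose indicator function restricts to a function in `N` form a Boolean algebra. -/
def indicatorAlgebra : BooleanSubalgebra (Set (OTWShift F)) where
  carrier := {S | Set.indicator (incl F ⁻¹' S) 1 ∈ N}
  infClosed' S hS T hT := by
    have := N.mul_mem hS hT
    rwa [← Set.inter_indicator_one] at this
  supClosed' S hS T hT := by
    have := N.sub_mem (N.add_mem hS hT) (N.mul_mem hS hT)
    rw [← Set.inter_indicator_one, ← Set.indicator_union_add_inter, add_sub_cancel_right] at this
    exact this
  compl_mem' {S} hS := by
    have := N.sub_mem N.one_mem hS
    rwa [← Set.indicator_compl] at this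
  bot_mem' := by
    rw [Set.mem_ofPred_eq, Set.bot_eq_empty, Set.preimage_empty, Set.indicator_empty']
    exact N.zero_mem

variable {N}

theorem mem_indicatorAlgebra {S : Set (OTWShift F)} :
    S ∈ indicatorAlgebra N ↔ Set.indicator (incl F ⁻¹' S) 1 ∈ N := Iff.rfl

theorem genCylinder_mem_indicatorAlgebra (h : ∀ α, cyl F α ∈ indicatorAlgebra N) (α : List A)
    (G : Finset A) : genCylinder F α G ∈ indicatorAlgebra N := by
  classical
  induction G using Finset.induction with
  | empty => exact h α
  | insert a G _ ih =>
    have : genCylinder F α (insert a G) = genCylinder F α G ⊓ (cyl F (α ++ [a]))ᶜ := by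
      ext y
      simp only [mem_genCylinder, Finset.mem_insert, forall_eq_or_imp, Set.inf_eq_inter,
        Set.mem_inter_iff, Set.mem_compl_iff]
      tauto
    rw [this]
    exact BooleanSubalgebra.inf_mem ih (BooleanSubalgebra.compl_mem (h _))

theorem exists_isOpen_mem_indicatorAlgebra (h : ∀ α, cyl F α ∈ indicatorAlgebra N)
    {O : Set (OTWShift F)} (hO : IsOpen O) {y : OTWShift F} (hy : y ∈ O) :
    ∃ S ∈ indicatorAlgebra N, IsOpen S ∧ y ∈ S ∧ S ⊆ O := by
  induction hO with
  | basic S hS =>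
    obtain ⟨α, -, G, rfl⟩ := hS
    exact ⟨_, genCylinder_mem_indicatorAlgebra h α G, isOpen_genCylinder α G, hy, subset_rfl⟩
  | univ => exact ⟨⊤, BooleanSubalgebra.top_mem, isOpen_univ, trivial, subset_rfl⟩
  | inter O₁ O₂ _ _ ih₁ ih₂ =>
    obtain ⟨S, hS, hSo, hyS, hSO⟩ := ih₁ hy.1
    obtain ⟨T, hT, hTo, hyT, hTO⟩ := ih₂ hy.2
    exact ⟨S ⊓ T, BooleanSubalgebra.inf_mem hS hT, hSo.inter hTo, ⟨hyS, hyT⟩, Set.inter_subset_inter hSO hTO⟩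
  | sUnion 𝒮 _ ih =>
    obtain ⟨O, hO, hyO⟩ := hy
    obtain ⟨S, hS, hSo, hyS, hSO⟩ := ih O hO hyO
    exact ⟨S, hS, hSo, hyS, hSO.trans (Set.subset_sUnion_of_mem hO)⟩

theorem isClopen_mem_indicatorAlgebra (h : ∀ α, cyl F α ∈ indicatorAlgebra N)
    {K : Set (OTWShift F)} (hK : IsClopen K) : K ∈ indicatorAlgebra N := by
  obtain ⟨S, hS, hKS, hSK⟩ : ∃ S ∈ indicatorAlgebra N, K ⊆ S ∧ S ⊆ K := by
    -- Asking for a set squeezed between `s` and `K` makes the predicate monotone in `s`, as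
    -- compactness induction requires; at `s = K` the set is `K` itself.
    refine hK.isClosed.isCompact.induction_on
      (p := fun s => ∃ S ∈ indicatorAlgebra N, s ⊆ S ∧ S ⊆ K) ⟨⊥, BooleanSubalgebra.bot_mem, by simp⟩ ?_ ?_ ?_
    · rintro s t hst ⟨S, hS, htS, hSK⟩
      exact ⟨S, hS, hst.trans htS, hSK⟩
    · rintro s t ⟨S, hS, hsS, hSK⟩ ⟨T, hT, htT, hTK⟩
      exact ⟨S ⊔ T, BooleanSubalgebra.sup_mem hS hT, Set.union_subset_union hsS htT, Set.union_subset hSK hTK⟩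
    · intro y hy
      obtain ⟨S, hS, hSo, hyS, hSK⟩ := exists_isOpen_mem_indicatorAlgebra h hK.isOpen hy
      exact ⟨S, mem_nhdsWithin_of_mem_nhds (hSo.mem_nhds hyS), S, hS, subset_rfl, hSK⟩
  rwa [hKS.antisymm hSK]

theorem comp_incl_mem (h : ∀ α, cyl F α ∈ indicatorAlgebra N)
    (f : LocallyConstant (OTWShift F) R) : f ∘ incl F ∈ N := by
  classical
  -- Compactness gives `f` a finite range, so it is a finite combination of indicators of its clopen
  -- fibres.
  have hf : f ∘ incl F =
      ∑ r ∈ f.range_finite.toFinset, r • Set.indicator (incl F ⁻¹' (f ⁻¹' {r})) 1 := by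
    ext x
    rw [Finset.sum_apply, Finset.sum_eq_single (f (incl F x))]
    · simp
    · intro r _ hr
      simp [hr.symm]
    · intro hx
      simp at hx
  rw [hf]
  exact N.sum_mem fun r _ => N.smul_mem
    (isClopen_mem_indicatorAlgebra h (f.isLocallyConstant.isClopen_fiber r)) r

end LocallyConstant

/-! ### Comparison of the two images -/

/-- Two injections with the same range: follow one by the inverse of the other. -/
theorem exists_bijective_nonUnitalAlgHom {R M N P : Type*} [CommRing R]
    [NonUnitalNonAssocSemiring M] [Module R M] [NonUnitalNonAssocSemiring N] [Module R N]
    [NonUnitalNonAssocSemiring P] [Module R P] (f : M →ₙₐ[R] P) (g : N →ₙₐ[R] P)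
    (hf : Function.Injective f) (hg : Function.Injective g) (hfg : ∀ m, ∃ n, g n = f m)
    (hgf : ∀ n, ∃ m, f m = g n) : ∃ φ : M →ₙₐ[R] N, Function.Bijective φ := by
  choose φ hφ using hfg
  refine ⟨{ toFun := φ, map_smul' := fun r m => hg ?_, map_zero' := hg ?_,
            map_add' := fun m m' => hg ?_, map_mul' := fun m m' => hg ?_ }, ?_, ?_⟩
  · simp [hφ]
  · simp [hφ]
  · simp [hφ]
  · simp [hφ]
  · intro m m' h
    apply hf
    rw [← hφ, ← hφ]
    exact congrArg g h
  · intro n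
    obtain ⟨m, hm⟩ := hgf n
    exact ⟨m, hg ((hφ m).trans hm)⟩

/-- Restriction of locally constant functions from the OTW-subshift to the subshift. -/
def restrict {A : Type u} (F : Set (List A)) (R : Type v) [CommRing R] :
    Lc (OTWShift F) R →ₙₐ[R] (subshift F → R) where
  toFun f := f.1 ∘ incl F
  map_smul' _ _ := rfl
  map_zero' := rfl
  map_add' _ _ := rfl
  map_mul' _ _ := rfl

theorem restrict_injective {A : Type u} (F : Set (List A)) (R : Type v) [CommRing R] :
    Function.Injective (restrict F R) :=
  fun _ _ h => Subtype.ext (eq_of_comp_incl_eq fun x => congrFun h x)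

theorem mem_Lc {Y : Type u} [TopologicalSpace Y] [CompactSpace Y] {R : Type v} [CommRing R]
    (f : LocallyConstant Y R) : f ∈ Lc Y R :=
  HasCompactSupport.of_compactSpace f

end OTW

theorem mainTheorem7 {A : Type*} (F : Set (List A)) {R : Type*} [CommRing R]
    (hR : ∀ e : R, IsIdempotentElem e → e = 0 ∨ e = 1) :
    ∃ φ : OTW.cylAlgebra R F →ₙₐ[R] OTW.Lc (OTW.OTWShift F) R, Function.Bijective φ := by
  open OTW in
  refine exists_bijective_nonUnitalAlgHom (cylAlgebraFun R F : _ →ₙₐ[R] _) (restrict F R)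
    (cylAlgebraFun_injective R) (restrict_injective F R)
    (fun e => ?_) fun f => ?_
  -- It suffices to treat the spanning elements: `s_α s_α^*` has the same function as the
  -- characteristic function of the clopen cylinder of `α`.
  · refine cylAlgebraFun_range_le R (M := (NonUnitalAlgHom.range (restrict F R)).toSubmodule)
      (fun α hα => ?_) e
    refine ⟨⟨LocallyConstant.charFn R (isClopen_cyl α), mem_Lc _⟩, funext fun x => ?_⟩
    rw [← preimage_incl_cyl]
    rfl
  -- Conversely, the range of `cylAlgebraFun` is a subalgebra, so it is enough that it contains the
  -- indicators of cylinders.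
  · refine comp_incl_mem (N := (cylAlgebraFun R F).range) (fun α => ?_) f.1
    rw [mem_indicatorAlgebra]
    by_cases hα : α ∈ language (subshift F)
    · exact ⟨_, (cylAlgebraFun_s_mul_sStar R hα).trans (by rw [preimage_incl_cyl])⟩
    · have : cyl F α = ∅ :=
        Set.eq_empty_of_forall_notMem fun y hy => hα (mem_language_of_mem_cyl hy)
      rw [this, Set.preimage_empty, Set.indicator_empty']
      exact Subalgebra.zero_mem _
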